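/- Let $g$ be a Lorentz inner product on $\mathbb{R}^4$, i.e. a real symmetric $4\times4$ matrix with $\det g<0$ (hence nondegenerate). Let $O(g)=\{\Lambda\in\mathbb{R}^{4\times4}:\Lambda^Tg\Lambda=g\}$ be the Lorentz group, and let $SO^+(g)$ be the connected component of the identity $I$ in $\{\Lambda\in O(g):\det\Lambda=1\}$. A simple Lorentz bivector is a matrix of the form $uv^Tg-vu^Tg$ with $u,v\in\mathbb{R}^4$; a Lorentz transformation $\Lambda\in O(g)$ is simple if $\Lambda=\exp(L)$ for some simple Lorentz bivector $L$, and nonsimple otherwise. Let $\mathrm{tr}_2\Lambda$ be the coefficient of $t^2$ in $\det(I+t\Lambda)$. Let $\Lambda\in SO^+(g)$ be nonsimple. Put $\Delta=(\mathrm{tr}\,\Lambda)^2-4\,\mathrm{tr}_2\Lambda+8$ and $$c_+=\cosh\Bigl(\cosh^{-1}\tfrac14\bigl(\mathrm{tr}\,\Lambda+\sqrt\Delta\bigr)\Bigr),\qquad c_-=\cos\Bigl(\cos^{-1}\tfrac14\bigl(\mathrm{tr}\,\Lambda-\sqrt\Delta\bigr)\Bigr).$$ These are well defined: $\Delta\ge0$,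 $c_\pm=\tfrac14(\mathrm{tr}\,\Lambda\pm\sqrt\Delta)$, and $c_+>1$, $-1\le c_-<1$. Moreover $\Lambda=\Lambda_+\Lambda_-$, where $$\Lambda_\pm=\pm\frac{1}{2(c_+-c_-)}\Bigl\{(1+2c_\pm)I-\Lambda^{-1}-(1+2c_\mp)\Lambda+\Lambda^2\Bigr\}$$ are commuting simple Lorentz transformations. -/

import Mathlib

namespace LorentzDecomp

/-- Real `4 × 4` matrices, identified with linear transformations of `ℝ⁴`. -/
abbrev Mat4 := Matrix (Fin 4) (Fin 4) ℝ

/-- A Lorentz inner product on `ℝ⁴`, given by its Gram matrix: symmetric, nondegenerate, and of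
negative determinant (nondegeneracy follows from `det g < 0`). No diagonal form is assumed. -/
structure IsLorentzMetric (g : Mat4) : Prop where
  symm : g.IsSymm
  det_neg : g.det < 0

/-- The `k`-th order trace of a square matrix: the coefficient of `t ^ k` in `det (I + t M)`. -/
noncomputable def kTrace {n : ℕ} (k : ℕ) (M : Matrix (Fin n) (Fin n) ℝ) : ℝ :=
  (Matrix.det (1 + (Polynomial.X : Polynomial ℝ) • M.map Polynomial.C)).coeff k

/-- The simple Lorentz bivector `u ∧^g v = u vᵀ g - v uᵀ g`. -/
def bivector (g : Mat4) (u v : Fin 4 → ℝ) : Mat4 :=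
  Matrix.vecMulVec u v * g - Matrix.vecMulVec v u * g

/-- A simple Lorentz bivector is a matrix of the form `u ∧^g v`. (Since `g` is symmetric, such a
matrix `L` satisfies `Lᵀ g + g L = 0`.) -/
def IsSimpleBivector (g L : Mat4) : Prop :=
  ∃ u v : Fin 4 → ℝ, L = bivector g u v

/-- The Lorentz group `O(g)`. -/
def lorentzGroup (g : Mat4) : Set Mat4 :=
  {Λ | Λ.transpose * g * Λ = g}

/-- The group of proper Lorentz transformations. -/
def properLorentzGroup (g : Mat4) : Set Mat4 :=
  {Λ | Λ ∈ lorentzGroup g ∧ Λ.det = 1}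

/-- `SO⁺(g)`: the identity component of the group of proper Lorentz transformations. -/
def properOrthochronous (g : Mat4) : Set Mat4 :=
  connectedComponentIn (properLorentzGroup g) 1

/-- A Lorentz transformation is simple if it is the exponential of a simple Lorentz bivector. -/
def IsSimpleLorentz (g Λ : Mat4) : Prop :=
  Λ ∈ lorentzGroup g ∧ ∃ L : Mat4, IsSimpleBivector g L ∧ NormedSpace.exp L = Λ

/-- `Δ = tr² Λ - 4 tr₂ Λ + 8`. -/
noncomputable def discr (Λ : Mat4) : ℝ :=
  Λ.trace ^ 2 - 4 * kTrace 2 Λ + 8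

/-- `√μ₊ = cosh⁻¹ (¼ (tr Λ + √Δ))`. -/
noncomputable def rootMuPlus (Λ : Mat4) : ℝ :=
  Real.arcosh ((Λ.trace + √(discr Λ)) / 4)

/-- `√(-μ₋) = cos⁻¹ (¼ (tr Λ - √Δ))`. -/
noncomputable def rootNegMuMinus (Λ : Mat4) : ℝ :=
  Real.arccos ((Λ.trace - √(discr Λ)) / 4)

/-- `c₊ = cosh √μ₊`. -/
noncomputable def cPlus (Λ : Mat4) : ℝ := Real.cosh (rootMuPlus Λ)

/-- `c₋ = cos √(-μ₋)`. -/
noncomputable def cMinus (Λ : Mat4) : ℝ := Real.cos (rootNegMuMinus Λ)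

/-- `Λ₊ = {(1 + 2c₊) I - Λ⁻¹ - (1 + 2c₋) Λ + Λ²} / (2 (c₊ - c₋))`. -/
noncomputable def factorPlus (Λ : Mat4) : Mat4 :=
  (1 / (2 * (cPlus Λ - cMinus Λ))) •
    ((1 + 2 * cPlus Λ) • (1 : Mat4) - Λ⁻¹ - (1 + 2 * cMinus Λ) • Λ + Λ ^ 2)

/-- `Λ₋ = -{(1 + 2c₋) I - Λ⁻¹ - (1 + 2c₊) Λ + Λ²} / (2 (c₊ - c₋))`. -/
noncomputable def factorMinus (Λ : Mat4) : Mat4 :=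
  -((1 / (2 * (cPlus Λ - cMinus Λ))) •
    ((1 + 2 * cMinus Λ) • (1 : Mat4) - Λ⁻¹ - (1 + 2 * cPlus Λ) • Λ + Λ ^ 2))

end LorentzDecomp

/-! A nonsimple `Λ` is a boost in a Lorentzian plane times a rotation in the orthogonal plane: `Λ =
exp (a • U) * exp (b • J)`, where `U * U` and `-(J * J)` are complementary idempotents and `U * J =
J * U = 0`. In the coordinates of `pairMat`, matrices multiply like pairs (split-complex number,
complex number). There `Λ` is `(cosh a, sinh a; cos b, sin b)`, its trace is `2 (cosh a + cos b)`,
and `Δ = 4 (cosh a - cos b)²`. Hence `c₊ = cosh a` and `c₋ = cos b`, and the formulas for the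
factors become identities between coordinates (`decomposition_of_normalForm`).

It remains to find the planes (`hasNormalForm`). Sylvester's law reduces `g` to `±eta`, and
connectedness gives `0 < Λ 0 0`. If `-1` is not an eigenvalue, the Cayley transform of `Λ` is an
infinitesimal isometry `skew z` with `z ∈ ℂ³`. If `z ⬝ᵥ z = 0` it is nilpotent and `Λ` is simple;
otherwise, scaling `z` by a complex number to a unit vector `n` gives `U = skew n`, `J = skew (I •
n)` (`hasNormalForm_of_cayley`). If `-1` is an eigenvalue, its eigenspace contains a spacelike
plane, on which `Λ` is a half turn, and `Λ` preserves the orthogonal plane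
(`hasNormalForm_of_det_eq_zero`). -/

namespace LorentzDecomp

open Matrix NormedSpace

/-! ### Second trace and closed forms of exponentials -/

/-- The second trace in terms of ordinary traces. -/
theorem kTrace_two (M : Mat4) : kTrace 2 M = (M.trace ^ 2 - (M * M).trace) / 2 := by
  have h : Matrix.det (1 + (Polynomial.X : Polynomial ℝ) • M.map Polynomial.C) =
      Polynomial.C 1 + Polynomial.C M.trace * Polynomial.X
        + Polynomial.C ((M 0 0 * M 1 1 - M 0 1 * M 1 0) + (M 0 0 * M 2 2 - M 0 2 * M 2 0)
          + (M 0 0 * M 3 3 - M 0 3 * M 3 0) + (M 1 1 * M 2 2 - M 1 2 * M 2 1)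
          + (M 1 1 * M 3 3 - M 1 3 * M 3 1) + (M 2 2 * M 3 3 - M 2 3 * M 3 2)) * Polynomial.X ^ 2
        + Polynomial.C (det !![M 0 0, M 0 1, M 0 2; M 1 0, M 1 1, M 1 2; M 2 0, M 2 1, M 2 2]
          + det !![M 0 0, M 0 1, M 0 3; M 1 0, M 1 1, M 1 3; M 3 0, M 3 1, M 3 3]
          + det !![M 0 0, M 0 2, M 0 3; M 2 0, M 2 2, M 2 3; M 3 0, M 3 2, M 3 3]
          + det !![M 1 1, M 1 2, M 1 3; M 2 1, M 2 2, M 2 3; M 3 1, M 3 2, M 3 3])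
            * Polynomial.X ^ 3
        + Polynomial.C M.det * Polynomial.X ^ 4 := by
    simp [det_succ_row_zero, Fin.sum_univ_succ, Matrix.one_apply, trace, Fin.succAbove,
      submatrix_apply]
    ring
  rw [kTrace, h]
  simp only [Polynomial.coeff_add, Polynomial.coeff_C_mul_X_pow, Polynomial.coeff_C,
    Polynomial.coeff_C_mul_X]
  simp [trace, Fin.sum_univ_four, mul_apply]
  ring

theorem exp_eq_of_hasSum {M S : Mat4}
    (h : HasSum (fun n : ℕ => ((n.factorial : ℝ)⁻¹) • M ^ n) S) : exp M = S := by
  rw [exp_eq_tsum ℝ]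
  exact h.tsum_eq

theorem exp_smul_of_cube_eq {U : Mat4} (hU : U * U * U = U) (a : ℝ) :
    exp (a • U) = 1 - U * U + (Real.cosh a • (U * U) + Real.sinh a • U) := by
  have ho : ∀ k : ℕ, U ^ (2 * k + 1) = U := by
    intro k
    induction k with
    | zero => simp
    | succ k ih => rw [show 2 * (k + 1) + 1 = 2 * k + 1 + 1 + 1 by ring, pow_succ, pow_succ, ih, hU]
  -- The zeroth power is `1`, not `U * U`; this accounts for the term `1 - U * U` outside the cosh
  -- series.
  have he : ∀ k : ℕ, U ^ (2 * k) = U * U + if k = 0 then 1 - U * U else 0 := by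
    intro k
    rcases k with _ | k
    · simp
    · rw [show 2 * (k + 1) = 2 * k + 1 + 1 by ring, pow_succ, ho]; simp
  apply exp_eq_of_hasSum
  rw [← add_assoc]
  refine HasSum.even_add_odd ?_ ?_
  · rw [add_comm]
    refine (((Real.hasSum_cosh a).smul_const (U * U)).add
      (hasSum_ite_eq (0 : ℕ) (1 - U * U : Mat4))).congr_fun fun k => ?_
    rw [smul_pow, he]
    rcases k with _ | k
    · simp
    · simp [smul_smul, div_eq_inv_mul]
  · refine ((Real.hasSum_sinh a).smul_const U).congr_fun fun k => ?_
    rw [smul_pow, ho, smul_smul, div_eq_inv_mul]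

theorem exp_smul_of_cube_eq_neg {J : Mat4} (hJ : J * J * J = -J) (b : ℝ) :
    exp (b • J) = 1 + J * J + (-(Real.cos b • (J * J)) + Real.sin b • J) := by
  have ho : ∀ k : ℕ, J ^ (2 * k + 1) = (-1 : ℝ) ^ k • J := by
    intro k
    induction k with
    | zero => simp
    | succ k ih =>
      rw [show 2 * (k + 1) + 1 = 2 * k + 1 + 1 + 1 by ring, pow_succ, pow_succ, ih, smul_mul_assoc,
        smul_mul_assoc, hJ, pow_succ]
      simp
  have he : ∀ k : ℕ, J ^ (2 * k) = (-1 : ℝ) ^ k • -(J * J) + if k = 0 then 1 + J * J else 0 := by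
    intro k
    rcases k with _ | k
    · simp
    · rw [show 2 * (k + 1) = 2 * k + 1 + 1 by ring, pow_succ, ho, pow_succ]; simp
  apply exp_eq_of_hasSum
  rw [← add_assoc]
  refine HasSum.even_add_odd ?_ ?_
  · rw [add_comm, ← smul_neg]
    refine (((Real.hasSum_cos b).smul_const (-(J * J))).add
      (hasSum_ite_eq (0 : ℕ) (1 + J * J : Mat4))).congr_fun fun k => ?_
    rw [smul_pow, he]
    rcases k with _ | k
    · simp
    · simp only [smul_add, smul_smul]
      simp
      congr 1
      ring
  · refine ((Real.hasSum_sin b).smul_const J).congr_fun fun k => ?_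
    rw [smul_pow, ho, smul_smul, smul_smul]
    congr 1
    ring

theorem exp_of_cube_eq_zero {N : Mat4} (hN : N * N * N = 0) :
    exp N = 1 + N + (1 / 2 : ℝ) • (N * N) := by
  apply exp_eq_of_hasSum
  have h := hasSum_sum_of_ne_finset_zero (f := fun n : ℕ => ((n.factorial : ℝ)⁻¹) • N ^ n)
    (s := Finset.range 3) (L := SummationFilter.unconditional ℕ) (by
      intro n hn
      obtain ⟨k, rfl⟩ : ∃ k, n = 3 + k := ⟨n - 3, by simp at hn; omega⟩
      simp [pow_add, show N ^ 3 = 0 by rw [pow_succ, sq, hN]])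
  simpa [Finset.sum_range_succ, sq, Nat.factorial] using h

/-! ### Simple bivectors and complementary pairs -/

theorem trace_bivector {g : Mat4} (hg : g.IsSymm) (u v : Fin 4 → ℝ) :
    (bivector g u v).trace = 0 := by
  rw [bivector, trace_sub, vecMulVec_mul, vecMulVec_mul, trace_vecMulVec, trace_vecMulVec,
    ← mulVec_transpose, ← mulVec_transpose, hg.eq, dotProduct_mulVec, ← mulVec_transpose, hg.eq,
    dotProduct_comm, sub_self]

theorem IsSimpleBivector.smul {g L : Mat4} (h : IsSimpleBivector g L) (a : ℝ) :
    IsSimpleBivector g (a • L) := by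
  obtain ⟨u, v, rfl⟩ := h
  exact ⟨a • u, v, by simp [bivector, smul_vecMulVec, vecMulVec_smul, smul_sub]⟩

theorem IsSimpleBivector.transpose_mul {g L : Mat4} (hg : g.IsSymm) (h : IsSimpleBivector g L) :
    Lᵀ * g = -(g * L) := by
  obtain ⟨u, v, rfl⟩ := h
  simp only [bivector, transpose_sub, Matrix.transpose_mul, transpose_vecMulVec, hg.eq]
  noncomm_ring

/-- The exponential of a simple bivector is a simple Lorentz transformation. -/
theorem IsSimpleBivector.exp {g L : Mat4} (hg : IsLorentzMetric g) (h : IsSimpleBivector g L) :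
    IsSimpleLorentz g (exp L) := by
  refine ⟨?_, L, h, rfl⟩
  have hu : IsUnit g := (isUnit_iff_isUnit_det g).2 hg.det_neg.ne.isUnit
  have hd : IsUnit g.det := hg.det_neg.ne.isUnit
  -- Since `Lᵀ` is conjugate to `-L` by `g`, the transpose of `exp L` is conjugate to its inverse by
  -- `g`.
  have h1 : Lᵀ = g * (-L) * g⁻¹ := by
    rw [mul_neg, ← h.transpose_mul hg.symm, mul_assoc, mul_nonsing_inv _ hd, mul_one]
  change (NormedSpace.exp L)ᵀ * g * NormedSpace.exp L = g
  rw [← exp_transpose, h1, exp_conj _ _ hu, mul_assoc _ g⁻¹ g, nonsing_inv_mul _ hd, mul_one,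
    mul_assoc, Matrix.exp_neg, nonsing_inv_mul, mul_one]
  exact (isUnit_iff_isUnit_det _).1 (isUnit_exp L)

/-- A pair of complementary simple bivectors: `U` squares to the identity of a Lorentzian plane,
`J` squares to minus the identity of the orthogonal plane. -/
structure IsUnitPair (g U J : Mat4) : Prop where
  left : IsSimpleBivector g U
  right : IsSimpleBivector g J
  sq_sub_sq : U * U - J * J = 1
  mul_eq_zero : U * J = 0
  mul_eq_zero' : J * U = 0
  trace_sq : (U * U).trace = 2

/-- The linear combinations of `U², U, -J², J`. -/
def pairMat (U J : Mat4) (p q r s : ℝ) : Mat4 :=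
  p • (U * U) + q • U - r • (J * J) + s • J

namespace IsUnitPair
variable {g U J : Mat4}

theorem cube_left (h : IsUnitPair g U J) : U * U * U = U := by
  have h1 : (U * U - J * J) * U = U := by rw [h.sq_sub_sq, one_mul]
  rwa [sub_mul, mul_assoc J, h.mul_eq_zero', mul_zero, sub_zero] at h1

theorem cube_right (h : IsUnitPair g U J) : J * J * J = -J := by
  have h1 : (U * U - J * J) * J = J := by rw [h.sq_sub_sq, one_mul]
  rw [sub_mul, mul_assoc U, h.mul_eq_zero, mul_zero, zero_sub] at h1
  exact neg_eq_iff_eq_neg.1 h1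

theorem one_eq (h : IsUnitPair g U J) : 1 = pairMat U J 1 0 1 0 := by
  rw [← h.sq_sub_sq]; simp [pairMat]

/-- `(p, q)` multiplies as `p + q j` with `j² = 1`, and `(r, s)` as `r + s i`; the cross terms
vanish. -/
theorem pairMat_mul (h : IsUnitPair g U J) (p q r s p' q' r' s' : ℝ) :
    pairMat U J p q r s * pairMat U J p' q' r' s' =
      pairMat U J (p * p' + q * q') (p * q' + q * p') (r * r' - s * s') (r * s' + s * r') := by
  have h1 : U * (U * U) = U := by rw [← mul_assoc, h.cube_left]
  have h2 : J * (J * J) = -J := by rw [← mul_assoc, h.cube_right]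
  have h3 : ∀ X, U * (J * X) = 0 := fun X => by rw [← mul_assoc, h.mul_eq_zero, zero_mul]
  have h4 : ∀ X, J * (U * X) = 0 := fun X => by rw [← mul_assoc, h.mul_eq_zero', zero_mul]
  simp only [pairMat, add_mul, mul_add, sub_mul, mul_sub, smul_mul_assoc, mul_smul_comm, mul_assoc,
    h1, h2, h3, h4, h.mul_eq_zero, h.mul_eq_zero', smul_zero, mul_neg,
    mul_zero]
  module

theorem exp_smul_left (h : IsUnitPair g U J) (a : ℝ) :
    exp (a • U) = pairMat U J (Real.cosh a) (Real.sinh a) 1 0 := by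
  rw [exp_smul_of_cube_eq h.cube_left, ← h.sq_sub_sq, pairMat]
  module

theorem exp_smul_right (h : IsUnitPair g U J) (b : ℝ) :
    exp (b • J) = pairMat U J 1 0 (Real.cos b) (Real.sin b) := by
  rw [exp_smul_of_cube_eq_neg h.cube_right, ← h.sq_sub_sq, pairMat]
  module

theorem trace_pairMat (hg : g.IsSymm) (h : IsUnitPair g U J) (p q r s : ℝ) :
    (pairMat U J p q r s).trace = 2 * p + 2 * r := by
  have hU : U.trace = 0 := by obtain ⟨u, v, e⟩ := h.left; rw [e, trace_bivector hg]
  have hJ : J.trace = 0 := by obtain ⟨u, v, e⟩ := h.right; rw [e, trace_bivector hg]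
  have hJJ : (J * J).trace = -2 := by
    have := congrArg trace h.sq_sub_sq
    rw [trace_sub, h.trace_sq, trace_one, Fintype.card_fin] at this
    push_cast at this
    linarith
  simp only [pairMat, trace_add, trace_sub, trace_smul, h.trace_sq, hU, hJ, hJJ, smul_eq_mul]
  ring

end IsUnitPair

theorem smul_pairMat (U J : Mat4) (c p q r s : ℝ) :
    c • pairMat U J p q r s = pairMat U J (c * p) (c * q) (c * r) (c * s) := by
  simp only [pairMat]; module

theorem pairMat_add (U J : Mat4) (p q r s p' q' r' s' : ℝ) :
    pairMat U J p q r s + pairMat U J p' q' r' s' =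
      pairMat U J (p + p') (q + q') (r + r') (s + s') := by
  simp only [pairMat]; module

theorem pairMat_sub (U J : Mat4) (p q r s p' q' r' s' : ℝ) :
    pairMat U J p q r s - pairMat U J p' q' r' s' =
      pairMat U J (p - p') (q - q') (r - r') (s - s') := by
  simp only [pairMat]; module

/-- A Lorentz transformation is either simple or the product of a boost and a rotation in
complementary planes. -/
def HasNormalForm (g Λ : Mat4) : Prop :=
  IsSimpleLorentz g Λ ∨ ∃ (U J : Mat4) (a b : ℝ), IsUnitPair g U J ∧
    Λ = pairMat U J (Real.cosh a) (Real.sinh a) (Real.cos b) (Real.sin b)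

/-- On the two planes, `Λ + Λ⁻¹` is `2c₊` and `2c₋` respectively. Substituting `Λ⁻¹ = 2c± - Λ` and
`Λ² = 2c± Λ - 1` shows that `factorPlus Λ` is `Λ` on the boost plane and `1` on the rotation plane;
`factorMinus Λ` is the reverse. -/
theorem decomposition_of_normalForm {g Λ : Mat4} (hg : IsLorentzMetric g)
    (hΛ : HasNormalForm g Λ) (hns : ¬ IsSimpleLorentz g Λ) :
    (0 ≤ discr Λ ∧ cPlus Λ = (Λ.trace + √(discr Λ)) / 4 ∧
      cMinus Λ = (Λ.trace - √(discr Λ)) / 4 ∧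
      1 < cPlus Λ ∧ -1 ≤ cMinus Λ ∧ cMinus Λ < 1) ∧
    Λ = factorPlus Λ * factorMinus Λ ∧
    Commute (factorPlus Λ) (factorMinus Λ) ∧
    IsSimpleLorentz g (factorPlus Λ) ∧
    IsSimpleLorentz g (factorMinus Λ) := by
  obtain hs | ⟨U, J, a, b, h, e⟩ := hΛ
  · exact absurd hs hns
  -- With `a = 0` only the rotation remains, with `cos b = 1` only the boost; either would make `Λ`
  -- simple.
  have ha : a ≠ 0 := by
    rintro rfl
    apply hns
    have := (h.right.smul b).exp hg
    rw [h.exp_smul_right] at this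
    simpa [e] using this
  have hb : Real.cos b ≠ 1 := by
    intro hb
    have hb' : Real.sin b = 0 := by
      have := Real.sin_sq_add_cos_sq b
      rw [hb] at this
      simpa using this
    apply hns
    have := (h.left.smul a).exp hg
    rw [h.exp_smul_left] at this
    simpa [e, hb, hb'] using this
  have hc : 1 < Real.cosh a := Real.one_lt_cosh.2 ha
  have hb1 : Real.cos b < 1 := lt_of_le_of_ne (Real.cos_le_one b) hb
  have hcs := Real.cosh_sq a
  have hsc := Real.sin_sq_add_cos_sq b
  have htr : Λ.trace = 2 * Real.cosh a + 2 * Real.cos b := by rw [e, h.trace_pairMat hg.symm]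
  have hΔ : discr Λ = (2 * (Real.cosh a - Real.cos b)) ^ 2 := by
    rw [discr, kTrace_two, htr, e, h.pairMat_mul, h.trace_pairMat hg.symm]
    linear_combination (-4) * hcs - 4 * hsc
  have hsq : √(discr Λ) = 2 * (Real.cosh a - Real.cos b) := by
    rw [hΔ, Real.sqrt_sq (by linarith)]
  have hp : (Λ.trace + √(discr Λ)) / 4 = Real.cosh a := by rw [hsq, htr]; ring
  have hm : (Λ.trace - √(discr Λ)) / 4 = Real.cos b := by rw [hsq, htr]; ring
  have hcp : cPlus Λ = Real.cosh a := by
    rw [cPlus, rootMuPlus, hp, Real.cosh_arcosh hc.le]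
  have hcm : cMinus Λ = Real.cos b := by
    rw [cMinus, rootNegMuMinus, hm, Real.cos_arccos (Real.neg_one_le_cos b) hb1.le]
  have hinv : Λ⁻¹ = pairMat U J (Real.cosh a) (-Real.sinh a) (Real.cos b) (-Real.sin b) := by
    apply inv_eq_right_inv
    rw [e, h.pairMat_mul, h.one_eq]
    congr 1
    · linear_combination hcs
    · ring
    · linear_combination hsc
    · ring
  have hne : Real.cosh a - Real.cos b ≠ 0 := by linarith
  have hP : factorPlus Λ = pairMat U J (Real.cosh a) (Real.sinh a) 1 0 := by
    rw [factorPlus, hcp, hcm, hinv, h.one_eq, sq, e, h.pairMat_mul]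
    simp only [smul_pairMat, pairMat_add, pairMat_sub]
    congr 1
    · field_simp
      linear_combination -hcs
    · field_simp
      ring
    · field_simp
      linear_combination -hsc
    · field_simp
      ring
  have hM : factorMinus Λ = pairMat U J 1 0 (Real.cos b) (Real.sin b) := by
    rw [factorMinus, hcp, hcm, hinv, h.one_eq, sq, e, h.pairMat_mul, ← neg_smul]
    simp only [smul_pairMat, pairMat_add, pairMat_sub]
    congr 1
    · field_simp
      linear_combination hcs
    · field_simp
      ring
    · field_simp
      linear_combination hsc
    · field_simp
      ring
  refine ⟨⟨hΔ ▸ sq_nonneg _, hcp.trans hp.symm, hcm.trans hm.symm, hcp ▸ hc,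
    hcm ▸ Real.neg_one_le_cos b, hcm ▸ hb1⟩, ?_, ?_, ?_, ?_⟩
  · rw [hP, hM, h.pairMat_mul, e]; simp
  · rw [hP, hM, Commute, SemiconjBy, h.pairMat_mul, h.pairMat_mul]; simp
  · rw [hP, ← h.exp_smul_left]; exact (h.left.smul a).exp hg
  · rw [hM, ← h.exp_smul_right]; exact (h.right.smul b).exp hg

/-! ### Change of basis and sign of the metric -/

section Transfer
variable {g h A B : Mat4}

/-- `B` is an isometry from `g` to `h` with inverse `A`, so `X ↦ A * X * B` carries the structures
of `h` to those of `g`. -/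
theorem bivector_conj (hg : g = Bᵀ * h * B) (hBA : B * A = 1) (u v : Fin 4 → ℝ) :
    A * bivector h u v * B = bivector g (A *ᵥ u) (A *ᵥ v) := by
  have key : ∀ u v : Fin 4 → ℝ,
      vecMulVec (A *ᵥ u) (A *ᵥ v) * g = A * (vecMulVec u v * h) * B := by
    intro u v
    rw [hg, ← mul_vecMulVec, ← vecMul_transpose, ← vecMulVec_mul]
    have : Aᵀ * Bᵀ = 1 := by rw [← Matrix.transpose_mul, hBA, transpose_one]
    calc A * (vecMulVec u v * Aᵀ) * (Bᵀ * h * B) = A * vecMulVec u v * (Aᵀ * Bᵀ) * h * B := by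
          simp only [mul_assoc]
      _ = _ := by rw [this, mul_one]; simp only [mul_assoc]
  rw [bivector, bivector, mul_sub, sub_mul, key, key]

theorem IsSimpleBivector.conj (hg : g = Bᵀ * h * B) (hBA : B * A = 1) {L : Mat4}
    (hL : IsSimpleBivector h L) : IsSimpleBivector g (A * L * B) := by
  obtain ⟨u, v, rfl⟩ := hL
  exact ⟨_, _, bivector_conj hg hBA u v⟩

theorem conj_mul_conj (hBA : B * A = 1) (X Y : Mat4) : A * X * B * (A * Y * B) = A * (X * Y) * B := by
  calc A * X * B * (A * Y * B) = A * X * (B * A) * Y * B := by simp only [mul_assoc]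
    _ = _ := by rw [hBA, mul_one]; simp only [mul_assoc]

theorem IsUnitPair.conj (hg : g = Bᵀ * h * B) (hBA : B * A = 1) {U J : Mat4}
    (H : IsUnitPair h U J) : IsUnitPair g (A * U * B) (A * J * B) where
  left := H.left.conj hg hBA
  right := H.right.conj hg hBA
  sq_sub_sq := by
    rw [conj_mul_conj hBA, conj_mul_conj hBA, ← sub_mul, ← mul_sub, H.sq_sub_sq, mul_one,
      mul_eq_one_comm.1 hBA]
  mul_eq_zero := by rw [conj_mul_conj hBA, H.mul_eq_zero, mul_zero, zero_mul]
  mul_eq_zero' := by rw [conj_mul_conj hBA, H.mul_eq_zero', mul_zero, zero_mul]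
  trace_sq := by
    rw [conj_mul_conj hBA, trace_mul_comm, ← mul_assoc, hBA, one_mul, H.trace_sq]

theorem pairMat_conj (hBA : B * A = 1) (U J : Mat4) (p q r s : ℝ) :
    pairMat (A * U * B) (A * J * B) p q r s = A * pairMat U J p q r s * B := by
  simp only [pairMat, conj_mul_conj hBA, mul_add, add_mul, mul_sub, sub_mul, mul_smul_comm,
    smul_mul_assoc]

theorem IsSimpleLorentz.conj (hg : g = Bᵀ * h * B) (hBA : B * A = 1) {X : Mat4}
    (H : IsSimpleLorentz h X) : IsSimpleLorentz g (A * X * B) := by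
  obtain ⟨hX, L, hL, rfl⟩ := H
  refine ⟨?_, _, hL.conj hg hBA, ?_⟩
  · change (A * exp L * B)ᵀ * g * (A * exp L * B) = g
    have : Aᵀ * Bᵀ = 1 := by rw [← Matrix.transpose_mul, hBA, transpose_one]
    have hX' : (exp L)ᵀ * h * exp L = h := hX
    rw [hg, Matrix.transpose_mul, Matrix.transpose_mul]
    calc Bᵀ * ((exp L)ᵀ * Aᵀ) * (Bᵀ * h * B) * (A * exp L * B)
        = Bᵀ * ((exp L)ᵀ * (Aᵀ * Bᵀ) * h * (B * A) * exp L) * B := by simp only [mul_assoc]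
      _ = _ := by rw [this, hBA, mul_one, mul_one, hX']
  · have hB : B = A⁻¹ := (inv_eq_left_inv hBA).symm
    rw [hB, exp_conj _ _ (IsUnit.of_mul_eq_one_right B hBA)]

theorem HasNormalForm.conj (hg : g = Bᵀ * h * B) (hBA : B * A = 1) {X : Mat4}
    (H : HasNormalForm h X) : HasNormalForm g (A * X * B) := by
  obtain H | ⟨U, J, a, b, hp, rfl⟩ := H
  · exact .inl (H.conj hg hBA)
  · exact .inr ⟨_, _, a, b, hp.conj hg hBA, (pairMat_conj hBA _ _ _ _ _ _).symm⟩

theorem IsSimpleBivector.of_neg {L : Mat4} (H : IsSimpleBivector (-g) L) :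
    IsSimpleBivector g L := by
  obtain ⟨u, v, rfl⟩ := H
  exact ⟨v, u, by simp only [bivector, mul_neg]; abel⟩

theorem HasNormalForm.of_neg {X : Mat4} (H : HasNormalForm (-g) X) : HasNormalForm g X := by
  obtain ⟨hX, L, hL, h⟩ | ⟨U, J, a, b, hp, h⟩ := H
  · exact .inl ⟨by simpa [lorentzGroup] using hX, L, hL.of_neg, h⟩
  · exact .inr ⟨U, J, a, b, ⟨hp.left.of_neg, hp.right.of_neg, hp.sq_sub_sq, hp.mul_eq_zero,
      hp.mul_eq_zero', hp.trace_sq⟩, h⟩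

end Transfer

/-! ### Minkowski bivectors as complex 3-vectors -/

/-- The Minkowski metric. -/
def eta : Mat4 := diagonal ![-1, 1, 1, 1]

theorem isLorentzMetric_eta : IsLorentzMetric eta := by
  refine ⟨by simp [eta, IsSymm], ?_⟩
  simp [eta, det_diagonal, Fin.prod_univ_four]

/-- The bivector of the Minkowski metric with electric part `Re z` and magnetic part `Im z`. -/
def skew (z : Fin 3 → ℂ) : Mat4 :=
  !![0, (z 0).re, (z 1).re, (z 2).re;
    (z 0).re, 0, -(z 2).im, (z 1).im;
    (z 1).re, (z 2).im, 0, -(z 0).im;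
    (z 2).re, -(z 1).im, (z 0).im, 0]

theorem exists_skew {C : Mat4} (h : Cᵀ * eta = -(eta * C)) : ∃ z, C = skew z := by
  refine ⟨![⟨C 0 1, C 3 2⟩, ⟨C 0 2, C 1 3⟩, ⟨C 0 3, C 2 1⟩], ?_⟩
  have H : ∀ i j, (Cᵀ * eta) i j = (-(eta * C)) i j := fun i j => by rw [h]
  simp only [eta, mul_diagonal, transpose_apply] at H
  ext i j
  have h1 := H i j
  fin_cases i <;> fin_cases j <;> simp [skew] at h1 ⊢ <;> linarith

/-- Multiplication by `I` sends (electric, magnetic) `(E, B)` to `(-B, E)`, which is Hodge duality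
up to sign. -/
theorem skew_add_smul (ζ : ℂ) (z : Fin 3 → ℂ) :
    skew (ζ • z) = ζ.re • skew z + ζ.im • skew (Complex.I • z) := by
  ext i j
  fin_cases i <;> fin_cases j <;> simp [skew] <;> ring

/-- For `z = E + iB`, `z ⬝ᵥ z = |E|² - |B|² + 2i E·B` collects the two invariants of a bivector;
this and the next two lemmas turn `z ⬝ᵥ z = 1` into the relations of `IsUnitPair`. -/
theorem skew_mul_skew_sub (z : Fin 3 → ℂ) :
    skew z * skew z - skew (Complex.I • z) * skew (Complex.I • z) = (z ⬝ᵥ z).re • 1 := by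
  ext i j
  fin_cases i <;> fin_cases j <;>
    simp [skew, dotProduct, Fin.sum_univ_three] <;> ring

theorem skew_mul_skew_I (z : Fin 3 → ℂ) :
    skew z * skew (Complex.I • z) = (-(z ⬝ᵥ z).im / 2) • 1 := by
  ext i j
  fin_cases i <;> fin_cases j <;>
    simp [skew, mul_apply, Fin.sum_univ_four, dotProduct, Fin.sum_univ_three] <;> ring

theorem skew_I_mul_skew (z : Fin 3 → ℂ) :
    skew (Complex.I • z) * skew z = (-(z ⬝ᵥ z).im / 2) • 1 := by
  ext i j
  fin_cases i <;> fin_cases j <;>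
    simp [skew, mul_apply, Fin.sum_univ_four, dotProduct, Fin.sum_univ_three] <;> ring

theorem trace_skew_mul_skew (z : Fin 3 → ℂ) :
    (skew z * skew z).trace = 2 * (z ⬝ᵥ z).re := by
  simp [skew, trace, Fin.sum_univ_four, dotProduct, Fin.sum_univ_three]
  ring

theorem isSimpleBivector_skew {z : Fin 3 → ℂ} (hz : (z ⬝ᵥ z).im = 0) :
    IsSimpleBivector eta (skew z) := by
  have h : (z 0).re * (z 0).im + (z 1).re * (z 1).im + (z 2).re * (z 2).im = 0 := by
    simp [dotProduct, Fin.sum_univ_three] at hz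
    linarith
  obtain ⟨e1, b1, h0⟩ : ∃ e b, z 0 = ⟨e, b⟩ := ⟨_, _, rfl⟩
  obtain ⟨e2, b2, h1⟩ : ∃ e b, z 1 = ⟨e, b⟩ := ⟨_, _, rfl⟩
  obtain ⟨e3, b3, h2⟩ : ∃ e b, z 2 = ⟨e, b⟩ := ⟨_, _, rfl⟩
  simp only [h0, h1, h2] at h
  by_cases hE : e1 ^ 2 + e2 ^ 2 + e3 ^ 2 = 0
  · obtain rfl : e1 = 0 := by nlinarith [sq_nonneg e1, sq_nonneg e2, sq_nonneg e3]
    obtain rfl : e2 = 0 := by nlinarith [sq_nonneg e2, sq_nonneg e3]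
    obtain rfl : e3 = 0 := by nlinarith [sq_nonneg e3]
    -- With `E = 0`, both witnesses are chosen spatial and orthogonal to `B`.
    by_cases hb : b3 = 0
    · refine ⟨![0, b2, -b1, 0], ![0, 0, 0, 1], ?_⟩
      ext i j
      fin_cases i <;> fin_cases j <;>
        simp [skew, bivector, eta, h0, h1, h2, hb]
    · refine ⟨![0, 1, 0, -b1 / b3], ![0, 0, -b3, b2], ?_⟩
      ext i j
      fin_cases i <;> fin_cases j <;>
        simp [skew, bivector, eta, h0, h1, h2, hb]
      all_goals field_simp
      all_goals ring
  -- The witnesses are `(1, B × E / |E|²)` and `(0, E)`; the magnetic part is right because `(B × E)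
  -- × E = -|E|² B` when `E·B = 0`.
  · refine ⟨![1, (b2 * e3 - b3 * e2) / (e1 ^ 2 + e2 ^ 2 + e3 ^ 2),
      (b3 * e1 - b1 * e3) / (e1 ^ 2 + e2 ^ 2 + e3 ^ 2),
      (b1 * e2 - b2 * e1) / (e1 ^ 2 + e2 ^ 2 + e3 ^ 2)], ![0, e1, e2, e3], ?_⟩
    ext i j
    fin_cases i <;> fin_cases j <;>
        simp [skew, bivector, eta, h0, h1, h2] <;> try field_simp
    all_goals first
      | ring1
      | linear_combination e1 * h
      | linear_combination -e1 * h
      | linear_combination e2 * h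
      | linear_combination -e2 * h
      | linear_combination e3 * h
      | linear_combination -e3 * h

theorem isUnitPair_skew {z : Fin 3 → ℂ} (hz : z ⬝ᵥ z = 1) :
    IsUnitPair eta (skew z) (skew (Complex.I • z)) where
  left := isSimpleBivector_skew (by simp [hz])
  right := isSimpleBivector_skew (by simp [hz])
  sq_sub_sq := by simp [skew_mul_skew_sub, hz]
  mul_eq_zero := by simp [skew_mul_skew_I, hz]
  mul_eq_zero' := by simp [skew_I_mul_skew, hz]
  trace_sq := by simp [trace_skew_mul_skew, hz]

theorem skew_zero_zero (z : Fin 3 → ℂ) : skew z 0 0 = 0 := by simp [skew]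

theorem skew_mul_skew_zero_zero_nonneg (z : Fin 3 → ℂ) : 0 ≤ (skew z * skew z) 0 0 := by
  have : (skew z * skew z) 0 0 = (z 0).re ^ 2 + (z 1).re ^ 2 + (z 2).re ^ 2 := by
    simp [skew]
    ring
  rw [this]
  positivity

theorem exists_cosh_sinh {p q : ℝ} (h : p ^ 2 - q ^ 2 = 1) (hp : 0 < p) :
    ∃ a, p = Real.cosh a ∧ q = Real.sinh a := by
  refine ⟨Real.arsinh q, ?_, (Real.sinh_arsinh q).symm⟩
  rw [Real.cosh_arsinh, show 1 + q ^ 2 = p ^ 2 by linarith, Real.sqrt_sq hp.le]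

theorem exists_cos_sin {r s : ℝ} (h : r ^ 2 + s ^ 2 = 1) :
    ∃ b, r = Real.cos b ∧ s = Real.sin b := by
  have hn : ‖(⟨r, s⟩ : ℂ)‖ = 1 := by
    rw [Complex.norm_def, Complex.normSq_mk, ← sq, ← sq, h, Real.sqrt_one]
  refine ⟨Complex.arg ⟨r, s⟩, ?_, ?_⟩
  · rw [Complex.cos_arg (norm_ne_zero_iff.1 (by simp [hn])), hn, div_one]
  · rw [Complex.sin_arg, hn, div_one]

/-- Only the branch `p ≤ -1` of the hyperbola must be excluded. With `x = (J * J) 0 0 ≥ 0` the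
time-time entry is `p (1 + x) - r x`, which is at most `-1` there because `r ≥ -1`. -/
theorem normalForm_of_pairMat {U J : Mat4} (h : IsUnitPair eta U J) {p q r s : ℝ}
    (hpq : p ^ 2 - q ^ 2 = 1) (hrs : r ^ 2 + s ^ 2 = 1) (h0 : 0 < pairMat U J p q r s 0 0) :
    HasNormalForm eta (pairMat U J p q r s) := by
  have hp : 0 < p := by
    by_contra! hp
    obtain ⟨z, hz⟩ := exists_skew (h.left.transpose_mul isLorentzMetric_eta.symm)
    obtain ⟨w, hw⟩ := exists_skew (h.right.transpose_mul isLorentzMetric_eta.symm)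
    have h1 : (U * U) 0 0 - (J * J) 0 0 = 1 := by rw [← Matrix.sub_apply, h.sq_sub_sq, one_apply_eq]
    have h2 : 0 ≤ (J * J) 0 0 := hw ▸ skew_mul_skew_zero_zero_nonneg w
    have h3 : U 0 0 = 0 := hz ▸ skew_zero_zero z
    have h4 : J 0 0 = 0 := hw ▸ skew_zero_zero w
    simp only [pairMat, Matrix.add_apply, Matrix.sub_apply, Matrix.smul_apply, h3, h4, smul_eq_mul] at h0
    have hp1 : p ≤ -1 := by nlinarith [sq_nonneg q]
    have hr1 : -1 ≤ r := by nlinarith [sq_nonneg s]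
    nlinarith
  obtain ⟨a, rfl, rfl⟩ := exists_cosh_sinh hpq hp
  obtain ⟨b, rfl, rfl⟩ := exists_cos_sin hrs
  exact .inr ⟨U, J, a, b, h, rfl⟩

/-! ### The case without eigenvalue -1: Cayley transforms -/

/-- Lorentz transformations without eigenvalue `-1` are Cayley transforms. -/
theorem exists_cayley {Λ : Mat4} (hΛ : Λᵀ * eta * Λ = eta) (hd : IsUnit (1 + Λ).det) :
    ∃ z, Λ * (1 - skew z) = 1 + skew z := by
  set R := (1 + Λ)⁻¹
  have h1 : (1 + Λ) * R = 1 := mul_nonsing_inv _ hd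
  have h3 : Rᵀ * (1 + Λᵀ) = 1 := by
    simpa only [Matrix.transpose_mul, transpose_add, transpose_one] using congrArg transpose h1
  have hC : ((Λ - 1) * R)ᵀ * eta = -(eta * ((Λ - 1) * R)) := by
    -- This is skewness of `(Λ - 1) * R` with the inverses cleared; the cross terms cancel and `ΛᵀηΛ
    -- = η` does the rest.
    have h4 : (Λ - 1)ᵀ * eta * (1 + Λ) + (1 + Λᵀ) * eta * (Λ - 1) = 0 := by
      rw [transpose_sub, transpose_one]
      calc (Λᵀ - 1) * eta * (1 + Λ) + (1 + Λᵀ) * eta * (Λ - 1)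
          = (Λᵀ * eta * Λ - eta) + (Λᵀ * eta * Λ - eta) := by noncomm_ring
        _ = 0 := by rw [hΛ, sub_self, add_zero]
    have h5 : Rᵀ * ((Λ - 1)ᵀ * eta * (1 + Λ) + (1 + Λᵀ) * eta * (Λ - 1)) * R = 0 := by
      rw [h4, mul_zero, zero_mul]
    rw [eq_neg_iff_add_eq_zero, ← h5, Matrix.transpose_mul]
    calc Rᵀ * (Λ - 1)ᵀ * eta + eta * ((Λ - 1) * R)
        = Rᵀ * (Λ - 1)ᵀ * eta * ((1 + Λ) * R) + Rᵀ * (1 + Λᵀ) * eta * ((Λ - 1) * R) := by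
          rw [h1, h3, one_mul, mul_one]
      _ = _ := by simp only [mul_add, add_mul, mul_assoc]
  obtain ⟨z, hz⟩ := exists_skew hC
  refine ⟨z, ?_⟩
  rw [← hz]
  calc Λ * (1 - (Λ - 1) * R) = Λ * ((1 + Λ) * R - (Λ - 1) * R) := by rw [h1]
    _ = (1 + Λ) * R + (Λ - 1) * R := by noncomm_ring
    _ = 1 + (Λ - 1) * R := by rw [h1]

/-- Here `C³ = 0`, so `(1 + C)(1 - C)⁻¹ = 1 + 2C + 2C²`, which is exactly `exp (2C)`. -/
theorem isSimpleLorentz_of_null_cayley {Λ : Mat4} {z : Fin 3 → ℂ} (hz : z ⬝ᵥ z = 0)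
    (h : Λ * (1 - skew z) = 1 + skew z) : IsSimpleLorentz eta Λ := by
  set C := skew z
  have h1 : C * C = skew (Complex.I • z) * skew (Complex.I • z) := by
    simpa [hz, sub_eq_zero] using skew_mul_skew_sub z
  have h2 : C * C * C = 0 := by
    rw [mul_assoc, h1, ← mul_assoc, skew_mul_skew_I, hz]
    simp
  have h3 : Λ = 1 + (2 : ℝ) • C + (2 : ℝ) • (C * C) := by
    calc Λ = Λ * (1 - C) * (1 + C + C * C) + Λ * (C * C * C) := by noncomm_ring
      _ = (1 + C) * (1 + C + C * C) := by rw [h, h2, mul_zero, add_zero]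
      _ = 1 + (2 : ℝ) • C + (2 : ℝ) • (C * C) + C * C * C := by
        rw [two_smul, two_smul]
        noncomm_ring
      _ = _ := by rw [h2, add_zero]
  have h4 : exp ((2 : ℝ) • C) = Λ := by
    rw [exp_of_cube_eq_zero (by simp [h2]), h3]
    simp only [smul_mul_assoc, mul_smul_comm]
    module
  rw [← h4]
  exact ((isSimpleBivector_skew (by simp [hz])).smul 2).exp isLorentzMetric_eta

theorem hasNormalForm_of_cayley {Λ : Mat4} {z : Fin 3 → ℂ} (h0 : 0 < Λ 0 0)
    (h : Λ * (1 - skew z) = 1 + skew z) : HasNormalForm eta Λ := by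
  by_cases hz : z ⬝ᵥ z = 0
  · exact .inl (isSimpleLorentz_of_null_cayley hz h)
  obtain ⟨ζ, hζ⟩ := IsAlgClosed.exists_pow_nat_eq (z ⬝ᵥ z) (n := 2) (by norm_num)
  have hζ0 : ζ ≠ 0 := by rintro rfl; exact hz (by rw [← hζ]; simp)
  obtain ⟨n, rfl⟩ : ∃ n, z = ζ • n := ⟨ζ⁻¹ • z, by rw [smul_inv_smul₀ hζ0]⟩
  have hn : n ⬝ᵥ n = 1 := by
    have hζ' : ζ ^ 2 * (n ⬝ᵥ n - 1) = 0 := by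
      rw [smul_dotProduct, dotProduct_smul, smul_eq_mul, smul_eq_mul] at hζ
      linear_combination -hζ
    exact sub_eq_zero.1 ((mul_eq_zero.1 hζ').resolve_left (pow_ne_zero 2 hζ0))
  have hp := isUnitPair_skew hn
  set U := skew n
  set J := skew (Complex.I • n)
  set α := ζ.re
  set β := ζ.im
  have hC : skew (ζ • n) = pairMat U J 0 α 0 β := by rw [skew_add_smul]; simp [pairMat, α, β, U, J]
  rw [hC, hp.one_eq, pairMat_sub, pairMat_add] at h
  -- If `α² = 1`, then `1 + αj` is a zero divisor annihilated by `1 - αj`: multiplying by it kills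
  -- the left side of `h` but leaves trace 4 on the right.
  have hα : 1 - α ^ 2 ≠ 0 := by
    intro hα
    have h1 := congrArg (· * pairMat U J 1 α 0 0) h
    simp only [mul_assoc, hp.pairMat_mul] at h1
    have h2 : pairMat U J ((1 - 0) * 1 + (0 - α) * α) ((1 - 0) * α + (0 - α) * 1)
        ((1 - 0) * 0 - (0 - β) * 0) ((1 - 0) * 0 + (0 - β) * 0) = 0 := by
      have : (1 - 0) * 1 + (0 - α) * α = 0 := by linarith
      rw [this]
      simp [pairMat]
    rw [h2, mul_zero] at h1
    have h3 := congrArg trace h1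
    rw [hp.trace_pairMat isLorentzMetric_eta.symm, trace_zero] at h3
    nlinarith
  have hβ : 1 + β ^ 2 ≠ 0 := by positivity
  have hΛ : Λ = pairMat U J ((1 + α ^ 2) / (1 - α ^ 2)) (2 * α / (1 - α ^ 2))
      ((1 - β ^ 2) / (1 + β ^ 2)) (2 * β / (1 + β ^ 2)) := by
    -- The multiplier is the inverse of `(1 - αj, 1 - βi)`.
    have h1 := congrArg (· * pairMat U J (1 / (1 - α ^ 2)) (α / (1 - α ^ 2))
      (1 / (1 + β ^ 2)) (β / (1 + β ^ 2))) h
    simp only [mul_assoc, hp.pairMat_mul] at h1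
    have h2 : ∀ p q r s : ℝ, p = 1 → q = 0 → r = 1 → s = 0 → pairMat U J p q r s = 1 := by
      rintro p q r s rfl rfl rfl rfl
      exact hp.one_eq.symm
    rw [h2 _ _ _ _ (by field_simp; ring) (by field_simp; ring) (by field_simp; ring)
      (by field_simp; ring), mul_one] at h1
    rw [h1]
    congr 1
    all_goals field_simp; ring
  rw [hΛ] at h0 ⊢
  refine normalForm_of_pairMat hp ?_ ?_ h0
  · field_simp
    ring
  · field_simp
    ring

/-! ### The case of eigenvalue -1 -/

/-- The Minkowski product. -/
def mink (u v : Fin 4 → ℝ) : ℝ := u ⬝ᵥ (eta *ᵥ v)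

theorem mink_eq (u v : Fin 4 → ℝ) :
    mink u v = -(u 0 * v 0) + u 1 * v 1 + u 2 * v 2 + u 3 * v 3 := by
  simp [mink, eta, mulVec_diagonal, dotProduct, Fin.sum_univ_four]

theorem mink_comm (u v : Fin 4 → ℝ) : mink u v = mink v u := by
  simp only [mink_eq]; ring

theorem mink_smul_left (c : ℝ) (u v : Fin 4 → ℝ) : mink (c • u) v = c * mink u v := by
  simp [mink_eq]; ring

theorem mink_smul_right (c : ℝ) (u v : Fin 4 → ℝ) : mink u (c • v) = c * mink u v := by
  simp [mink_eq]; ring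

theorem mink_mulVec {Λ : Mat4} (hΛ : Λᵀ * eta * Λ = eta) (u v : Fin 4 → ℝ) :
    mink (Λ *ᵥ u) (Λ *ᵥ v) = mink u v := by
  rw [mink, mulVec_mulVec, ← vecMul_transpose, ← dotProduct_mulVec, mulVec_mulVec, ← mul_assoc, hΛ,
    mink]

/-- If `y` were not spacelike, Cauchy–Schwarz for the spatial parts and `x` timelike would force `y
0 = 0`, hence `y = 0`. -/
theorem mink_self_pos_of_orthogonal {x y : Fin 4 → ℝ} (hx : mink x x < 0) (hxy : mink x y = 0)
    (hy : y ≠ 0) : 0 < mink y y := by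
  by_contra! h
  apply hy
  rw [mink_eq] at hx hxy h
  have hcs : (x 1 * y 1 + x 2 * y 2 + x 3 * y 3) ^ 2 ≤
      (x 1 ^ 2 + x 2 ^ 2 + x 3 ^ 2) * (y 1 ^ 2 + y 2 ^ 2 + y 3 ^ 2) := by
    nlinarith [sq_nonneg (x 1 * y 2 - x 2 * y 1), sq_nonneg (x 1 * y 3 - x 3 * y 1),
      sq_nonneg (x 2 * y 3 - x 3 * y 2)]
  have h1 : x 1 * y 1 + x 2 * y 2 + x 3 * y 3 = x 0 * y 0 := by linarith
  rw [h1] at hcs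
  have h2 : (x 1 ^ 2 + x 2 ^ 2 + x 3 ^ 2) * (y 1 ^ 2 + y 2 ^ 2 + y 3 ^ 2) ≤
      (x 1 ^ 2 + x 2 ^ 2 + x 3 ^ 2) * y 0 ^ 2 :=
    mul_le_mul_of_nonneg_left (by nlinarith) (by positivity)
  have h3 : y 0 ^ 2 * (x 0 ^ 2 - (x 1 ^ 2 + x 2 ^ 2 + x 3 ^ 2)) ≤ 0 := by nlinarith
  have h4 : y 0 ^ 2 = 0 := le_antisymm (nonpos_of_mul_nonpos_left h3 (by nlinarith)) (sq_nonneg _)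
  have h5 : y 0 = 0 := by simpa using h4
  rw [h5] at h
  ext i
  fin_cases i
  · exact h5
  · simpa using (by nlinarith [sq_nonneg (y 1), sq_nonneg (y 2), sq_nonneg (y 3)] : y 1 ^ 2 = 0)
  · simpa using (by nlinarith [sq_nonneg (y 1), sq_nonneg (y 2), sq_nonneg (y 3)] : y 2 ^ 2 = 0)
  · simpa using (by nlinarith [sq_nonneg (y 1), sq_nonneg (y 2), sq_nonneg (y 3)] : y 3 ^ 2 = 0)

theorem eta_mul_eta : eta * eta = 1 := by
  rw [eta, diagonal_mul_diagonal, ← diagonal_one]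
  congr 1
  ext i
  fin_cases i <;> simp

/-- The transpose of a Lorentz transformation is a Lorentz transformation. -/
theorem mul_eta_mul_transpose {Λ : Mat4} (hΛ : Λᵀ * eta * Λ = eta) : Λ * eta * Λᵀ = eta := by
  have h1 : eta * Λᵀ * eta * Λ = 1 := by
    rw [mul_assoc eta, mul_assoc eta, hΛ, eta_mul_eta]
  have h2 : Λ * (eta * Λᵀ * eta) = 1 := mul_eq_one_comm.1 h1
  calc Λ * eta * Λᵀ = Λ * (eta * Λᵀ * eta) * eta := by
        simp only [mul_assoc, eta_mul_eta, mul_one]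
    _ = eta := by rw [h2, one_mul]

theorem sq_zero_zero {Λ : Mat4} (hΛ : Λᵀ * eta * Λ = eta) :
    Λ 0 0 ^ 2 = 1 + Λ 0 1 ^ 2 + Λ 0 2 ^ 2 + Λ 0 3 ^ 2 := by
  have h := congrFun₂ (mul_eta_mul_transpose hΛ) 0 0
  simp [eta, mul_apply, Fin.sum_univ_four] at h
  linarith

/-- An eigenvector of an orthochronous transformation for the eigenvalue `-1` is spacelike. -/
theorem mink_self_pos_of_mulVec_eq_neg {Λ : Mat4} (hΛ : Λᵀ * eta * Λ = eta) (h0 : 0 < Λ 0 0)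
    {v : Fin 4 → ℝ} (hv : v ≠ 0) (h : Λ *ᵥ v = -v) : 0 < mink v v := by
  have hr := sq_zero_zero hΛ
  have h1 := congrFun h 0
  simp only [mulVec, dotProduct, Fin.sum_univ_four, Pi.neg_apply] at h1
  -- The vector is `(1 + Λ⁻¹) e₀`: its product with `v` is `-(v + Λ v) 0 = 0`, and its square is `-2
  -- - 2 Λ 0 0 < 0`.
  refine mink_self_pos_of_orthogonal (x := ![1 + Λ 0 0, -Λ 0 1, -Λ 0 2, -Λ 0 3]) ?_ ?_ hv
  · simp [mink_eq]
    nlinarith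
  · simp [mink_eq]
    linarith

theorem exists_mulVec_eq_neg {Λ : Mat4} (h : (1 + Λ).det = 0) : ∃ v, v ≠ 0 ∧ Λ *ᵥ v = -v := by
  obtain ⟨v, hv, h⟩ := exists_mulVec_eq_zero_iff.2 h
  rw [add_mulVec, one_mulVec] at h
  exact ⟨v, hv, (neg_eq_of_add_eq_zero_right h).symm⟩

theorem exists_smul_mink_self {v : Fin 4 → ℝ} (h : 0 < mink v v) :
    ∃ c : ℝ, mink (c • v) (c • v) = 1 := by
  refine ⟨(√(mink v v))⁻¹, ?_⟩
  rw [mink_smul_left, mink_smul_right, ← mul_assoc, ← mul_inv, Real.mul_self_sqrt h.le,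
    inv_mul_cancel₀ h.ne']

/-- The reflection in the hyperplane orthogonal to `v`, if `mink v v = 1`. -/
def reflection (v : Fin 4 → ℝ) : Mat4 := 1 - (2 : ℝ) • vecMulVec v (eta *ᵥ v)

theorem reflection_mulVec (v x : Fin 4 → ℝ) :
    reflection v *ᵥ x = x - (2 * mink v x) • v := by
  rw [reflection, sub_mulVec, one_mulVec, smul_mulVec, vecMulVec_mulVec, op_smul_eq_smul,
    dotProduct_comm, ← mink, mink_comm, smul_smul]

theorem reflection_mem {v : Fin 4 → ℝ} (hv : mink v v = 1) :
    (reflection v)ᵀ * eta * reflection v = eta := by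
  have h1 : v ᵥ* eta = eta *ᵥ v := by
    rw [← mulVec_transpose, isLorentzMetric_eta.symm.eq]
  have h2 : (eta *ᵥ v) ⬝ᵥ v = 1 := by rw [dotProduct_comm]; exact hv
  simp only [reflection, transpose_sub, transpose_one, transpose_smul, transpose_vecMulVec, sub_mul,
    mul_sub, one_mul, mul_one, smul_mul_assoc, mul_smul_comm, vecMulVec_mul, mul_vecMulVec,
    vecMulVec_mulVec, h1, h2, MulOpposite.op_one, one_smul]
  module

theorem det_reflection {v : Fin 4 → ℝ} (hv : mink v v = 1) : (reflection v).det = -1 := by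
  have h2 : (eta *ᵥ v) ⬝ᵥ v = 1 := by rw [dotProduct_comm]; exact hv
  rw [reflection, sub_eq_add_neg, ← neg_smul, ← smul_vecMulVec, vecMulVec_eq Unit,
    det_one_add_replicateCol_mul_replicateRow, dotProduct_smul, h2]
  norm_num

/-- The eigenspace of a proper orthochronous transformation for the eigenvalue `-1` is at least
two-dimensional, if it is nontrivial. -/
theorem exists_orthonormal_mulVec_eq_neg {Λ : Mat4} (hΛ : Λᵀ * eta * Λ = eta) (hd : Λ.det = 1)
    (h0 : 0 < Λ 0 0) (h : (1 + Λ).det = 0) :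
    ∃ u v, Λ *ᵥ u = -u ∧ Λ *ᵥ v = -v ∧ mink u u = 1 ∧ mink v v = 1 ∧ mink u v = 0 := by
  obtain ⟨v, hv, hc⟩ : ∃ v, Λ *ᵥ v = -v ∧ mink v v = 1 := by
    obtain ⟨v, hv0, hv⟩ := exists_mulVec_eq_neg h
    obtain ⟨c, hc⟩ := exists_smul_mink_self (mink_self_pos_of_mulVec_eq_neg hΛ h0 hv0 hv)
    exact ⟨c • v, by rw [mulVec_smul, hv, smul_neg], hc⟩
  -- `Λ * ρ` fixes `v` and has determinant `-1`, hence has eigenvalue `-1`. Such an eigenvector is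
  -- orthogonal to `v`, so `ρ` fixes it and it is an eigenvector of `Λ` too.
  set ρ := reflection v
  have hρx : ∀ x, ρ *ᵥ x = x - (2 * mink v x) • v := reflection_mulVec v
  have hρη : ρᵀ * eta * ρ = eta := reflection_mem hc
  have hρd : ρ.det = -1 := det_reflection hc
  have hM : (Λ * ρ)ᵀ * eta * (Λ * ρ) = eta := by
    rw [Matrix.transpose_mul]
    calc ρᵀ * Λᵀ * eta * (Λ * ρ) = ρᵀ * (Λᵀ * eta * Λ) * ρ := by simp only [mul_assoc]
      _ = eta := by rw [hΛ, hρη]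
  have hM1 : (1 + Λ * ρ).det = 0 := by
    -- Taking determinants gives `-det (1 + Λρ) = det (1 + Λρ)`, up to the nonzero factor `det η`.
    have h1 : (Λ * ρ)ᵀ * eta * (1 + Λ * ρ) = (1 + Λ * ρ)ᵀ * eta := by
      rw [mul_add, hM, mul_one, transpose_add, transpose_one, add_mul, one_mul, add_comm]
    have h2 := congrArg det h1
    simp only [det_mul, det_transpose, hd, hρd] at h2
    have h3 := isLorentzMetric_eta.det_neg.ne
    have h4 : (1 + Λ * ρ).det * eta.det = 0 := by linarith
    exact (mul_eq_zero.1 h4).resolve_right h3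
  obtain ⟨u', hu0', hu'⟩ := exists_mulVec_eq_neg hM1
  have hMv : (Λ * ρ) *ᵥ v = v := by
    rw [← mulVec_mulVec, hρx, hc, mulVec_sub, mulVec_smul, hv]
    module
  have hvu : mink v u' = 0 := by
    have := mink_mulVec hM v u'
    rw [hMv, hu', ← neg_one_smul ℝ u', mink_smul_right] at this
    linarith
  have hu : Λ *ᵥ u' = -u' := by
    rwa [← mulVec_mulVec, hρx, hvu, mul_zero, zero_smul, sub_zero] at hu'
  obtain ⟨d, hd⟩ := exists_smul_mink_self (mink_self_pos_of_mulVec_eq_neg hΛ h0 hu0' hu)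
  refine ⟨d • u', v, by rw [mulVec_smul, hu, smul_neg], hv, hd, hc, ?_⟩
  rw [mink_smul_left, mink_comm, hvu, mul_zero]

/-- An orthonormal pair of spacelike vectors extends to a Lorentz frame. -/
theorem exists_frame {u v : Fin 4 → ℝ} (hu : mink u u = 1) (hv : mink v v = 1)
    (huv : mink u v = 0) : ∃ W : Mat4, Wᵀ * eta * W = eta ∧ W.col 2 = u ∧ W.col 3 = v := by
  obtain ⟨x, hx, hxu, hxv⟩ : ∃ x, mink x x = -1 ∧ mink x u = 0 ∧ mink x v = 0 := by
    -- The projection of `e₀` orthogonal to `u` and `v`; the plus signs come from `mink e₀ u = -u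
    -- 0`.
    set e : Fin 4 → ℝ := Pi.single 0 1 + u 0 • u + v 0 • v with he
    have hee : mink e e = -(1 + u 0 ^ 2 + v 0 ^ 2) := by
      simp only [mink_eq] at hu hv huv ⊢
      simp [he]
      linear_combination u 0 ^ 2 * hu + v 0 ^ 2 * hv + 2 * u 0 * v 0 * huv
    have heu : mink e u = 0 := by
      simp only [mink_eq] at hu hv huv ⊢
      simp [he]
      linear_combination u 0 * hu + v 0 * huv
    have hev : mink e v = 0 := by
      simp only [mink_eq] at hu hv huv ⊢
      simp [he]
      linear_combination v 0 * hv + u 0 * huv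
    have hpos : 0 < 1 + u 0 ^ 2 + v 0 ^ 2 := by positivity
    refine ⟨(√(1 + u 0 ^ 2 + v 0 ^ 2))⁻¹ • e, ?_, ?_, ?_⟩
    · rw [mink_smul_left, mink_smul_right, hee, ← mul_assoc, ← mul_inv, Real.mul_self_sqrt hpos.le,
        mul_neg, inv_mul_cancel₀ hpos.ne']
    · rw [mink_smul_left, heu, mul_zero]
    · rw [mink_smul_left, hev, mul_zero]
  obtain ⟨y, hy, hxy, huy, hvy⟩ : ∃ y, mink y y = 1 ∧ mink x y = 0 ∧ mink u y = 0 ∧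
      mink v y = 0 := by
    -- The zero row makes the matrix singular; a kernel vector is orthogonal to `x`, `u` and `v`.
    have hdet : (of ![x, u, v, 0] * eta).det = 0 := by
      rw [det_mul, det_eq_zero_of_row_eq_zero 3 (by simp), zero_mul]
    obtain ⟨y, hy0, hy⟩ := exists_mulVec_eq_zero_iff.2 hdet
    rw [← mulVec_mulVec] at hy
    have h1 : mink x y = 0 := congrFun hy 0
    have h2 : mink u y = 0 := congrFun hy 1
    have h3 : mink v y = 0 := congrFun hy 2
    obtain ⟨c, hc⟩ := exists_smul_mink_self
      (mink_self_pos_of_orthogonal (by rw [hx]; norm_num) h1 hy0)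
    exact ⟨c • y, hc, by simp [mink_smul_right, h1], by simp [mink_smul_right, h2],
      by simp [mink_smul_right, h3]⟩
  refine ⟨(of ![x, y, u, v])ᵀ, ?_, rfl, rfl⟩
  have key : ∀ i j, ((of ![x, y, u, v])ᵀᵀ * eta * (of ![x, y, u, v])ᵀ) i j =
      mink (![x, y, u, v] i) (![x, y, u, v] j) := by
    intro i j
    rw [mul_assoc]
    rfl
  ext i j
  rw [key]
  fin_cases i <;> fin_cases j <;>
    simp [eta, hx, hy, hu, hv, hxy, hxu, hxv, huv, mink_comm y x, mink_comm u x, mink_comm v x,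
      mink_comm y u, mink_comm y v, huy, hvy, mink_comm v u]

/-- A proper Lorentz transformation acting as `-1` on the last two coordinates. -/
theorem exists_eq_pairMat {M : Mat4} (hM : Mᵀ * eta * M = eta) (hd : M.det = 1)
    (h2 : M.col 2 = -Pi.single 2 1) (h3 : M.col 3 = -Pi.single 3 1) :
    ∃ p q : ℝ, p ^ 2 - q ^ 2 = 1 ∧
      M = pairMat (skew ![1, 0, 0]) (skew (Complex.I • ![1, 0, 0])) p q (-1) 0 := by
  have c02 : M 0 2 = 0 := by simpa using congrFun h2 0
  have c12 : M 1 2 = 0 := by simpa using congrFun h2 1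
  have c22 : M 2 2 = -1 := by simpa using congrFun h2 2
  have c32 : M 3 2 = 0 := by simpa using congrFun h2 3
  have c03 : M 0 3 = 0 := by simpa using congrFun h3 0
  have c13 : M 1 3 = 0 := by simpa using congrFun h3 1
  have c23 : M 2 3 = 0 := by simpa using congrFun h3 2
  have c33 : M 3 3 = -1 := by simpa using congrFun h3 3
  have H : ∀ i j, -(M 0 i * M 0 j) + M 1 i * M 1 j + M 2 i * M 2 j + M 3 i * M 3 j = eta i j := by
    intro i j
    have := congrFun₂ hM i j
    simp [mul_apply, Fin.sum_univ_four, eta] at this ⊢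
    linarith
  have r20 : M 2 0 = 0 := by simpa [c02, c12, c22, c32, eta] using H 0 2
  have r21 : M 2 1 = 0 := by simpa [c02, c12, c22, c32, eta] using H 1 2
  have r30 : M 3 0 = 0 := by simpa [c03, c13, c23, c33, eta] using H 0 3
  have r31 : M 3 1 = 0 := by simpa [c03, c13, c23, c33, eta] using H 1 3
  have e00 : -(M 0 0 * M 0 0) + M 1 0 * M 1 0 = -1 := by simpa [r20, r30, eta] using H 0 0
  have e01 : -(M 0 0 * M 0 1) + M 1 0 * M 1 1 = 0 := by simpa [r20, r30, eta] using H 0 1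
  have ed : M 0 0 * M 1 1 - M 0 1 * M 1 0 = 1 := by
    simp [det_succ_row_zero, Fin.sum_univ_succ, Fin.succAbove, c02, c03, c12, c13, c22, c23, c32,
      c33] at hd
    linarith
  -- The remaining block is an isometry of the 1+1 Minkowski plane of determinant 1, so it has the
  -- form `(p, q; q, p)`.
  have f11 : M 1 1 = M 0 0 := by
    linear_combination M 1 1 * e00 + M 0 0 * ed - M 1 0 * e01
  have f10 : M 1 0 = M 0 1 := by
    linear_combination (-M 0 1) * e00 + M 0 0 * e01 - M 1 0 * ed
  refine ⟨M 0 0, M 0 1, ?_, ?_⟩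
  · rw [f10] at e00
    linarith
  · ext i j
    fin_cases i <;> fin_cases j <;>
      simp [pairMat, skew, c02, c03, c12, c13, c22, c23, c32, c33,
        r20, r21, r30, r31, f11, f10]

theorem hasNormalForm_of_det_eq_zero {Λ : Mat4} (hΛ : Λᵀ * eta * Λ = eta) (hd : Λ.det = 1)
    (h0 : 0 < Λ 0 0) (h : (1 + Λ).det = 0) : HasNormalForm eta Λ := by
  obtain ⟨u, v, hu, hv, huu, hvv, huv⟩ := exists_orthonormal_mulVec_eq_neg hΛ hd h0 h
  obtain ⟨W, hW, hWu, hWv⟩ := exists_frame huu hvv huv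
  set B := eta * Wᵀ * eta with hB
  have hBW : B * W = 1 := by rw [hB, mul_assoc eta, mul_assoc eta, hW, eta_mul_eta]
  have hWB : W * B = 1 := mul_eq_one_comm.1 hBW
  have hη : eta = Bᵀ * eta * B := by
    have : Bᵀ * Wᵀ = 1 := by rw [← Matrix.transpose_mul, hWB, transpose_one]
    calc eta = Bᵀ * Wᵀ * eta * (W * B) := by rw [this, hWB, one_mul, mul_one]
      _ = Bᵀ * (Wᵀ * eta * W) * B := by simp only [mul_assoc]
      _ = _ := by rw [hW]
  have hM : (B * Λ * W)ᵀ * eta * (B * Λ * W) = eta := by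
    rw [Matrix.transpose_mul, Matrix.transpose_mul]
    calc Wᵀ * (Λᵀ * Bᵀ) * eta * (B * Λ * W) = Wᵀ * (Λᵀ * (Bᵀ * eta * B) * Λ) * W := by
          simp only [mul_assoc]
      _ = eta := by rw [← hη, hΛ, hW]
  have hMd : (B * Λ * W).det = 1 := by
    rw [det_mul_right_comm, hBW, one_mul, hd]
  have hcol : ∀ i w, W.col i = w → Λ *ᵥ w = -w → (B * Λ * W).col i = -Pi.single i 1 := by
    rintro i w rfl hw
    have h1 : W.col i = W *ᵥ Pi.single i 1 := by rw [mulVec_single_one]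
    rw [← mulVec_single_one, ← mulVec_mulVec, ← h1, ← mulVec_mulVec, hw, mulVec_neg, h1,
      mulVec_mulVec, hBW, one_mulVec]
  obtain ⟨p, q, hpq, hpair⟩ := exists_eq_pairMat hM hMd (hcol 2 u hWu hu) (hcol 3 v hWv hv)
  have hU : IsUnitPair eta (skew ![1, 0, 0]) (skew (Complex.I • ![1, 0, 0])) :=
    isUnitPair_skew (by simp [dotProduct, Fin.sum_univ_three])
  have hΛ' : Λ = pairMat (W * skew ![1, 0, 0] * B) (W * skew (Complex.I • ![1, 0, 0]) * B)
      p q (-1) 0 := by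
    rw [pairMat_conj hBW, ← hpair]
    calc Λ = (W * B) * Λ * (W * B) := by rw [hWB, one_mul, mul_one]
      _ = _ := by simp only [mul_assoc]
  rw [hΛ'] at h0 ⊢
  exact normalForm_of_pairMat (hU.conj hη hBW) hpq (by norm_num) h0

/-! ### Normal form for an arbitrary metric -/

theorem hasNormalForm_eta {Λ : Mat4} (hΛ : Λᵀ * eta * Λ = eta) (hd : Λ.det = 1)
    (h0 : 0 < Λ 0 0) : HasNormalForm eta Λ := by
  by_cases h : (1 + Λ).det = 0
  · exact hasNormalForm_of_det_eq_zero hΛ hd h0 h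
  · obtain ⟨z, hz⟩ := exists_cayley hΛ (Ne.isUnit h)
    exact hasNormalForm_of_cayley h0 hz

theorem hasNormalForm_of_congruent {g B Λ : Mat4} (hg : g = Bᵀ * eta * B) (hB : IsUnit B.det)
    (hΛ : Λ ∈ properOrthochronous g) : HasNormalForm g Λ := by
  have hBA : B * B⁻¹ = 1 := mul_nonsing_inv _ hB
  have hAB : B⁻¹ * B = 1 := nonsing_inv_mul _ hB
  have hgη : (B⁻¹)ᵀ * g * B⁻¹ = eta := by
    have : (B⁻¹)ᵀ * Bᵀ = 1 := by rw [← Matrix.transpose_mul, hBA, transpose_one]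
    calc (B⁻¹)ᵀ * g * B⁻¹ = (B⁻¹)ᵀ * Bᵀ * eta * (B * B⁻¹) := by rw [hg]; simp only [mul_assoc]
      _ = eta := by rw [this, hBA, one_mul, mul_one]
  have hmem : ∀ X ∈ properLorentzGroup g,
      (B * X * B⁻¹)ᵀ * eta * (B * X * B⁻¹) = eta ∧ (B * X * B⁻¹).det = 1 := by
    rintro X ⟨hX, hXd⟩
    have hX' : Xᵀ * g * X = g := hX
    refine ⟨?_, by rw [det_mul_right_comm, hBA, one_mul, hXd]⟩
    rw [Matrix.transpose_mul, Matrix.transpose_mul]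
    calc (B⁻¹)ᵀ * (Xᵀ * Bᵀ) * eta * (B * X * B⁻¹)
        = (B⁻¹)ᵀ * (Xᵀ * (Bᵀ * eta * B) * X) * B⁻¹ := by simp only [mul_assoc]
      _ = eta := by rw [← hg, hX', hgη]
  have hsub : properOrthochronous g ⊆ properLorentzGroup g := connectedComponentIn_subset _ _
  have h1 : (1 : Mat4) ∈ properOrthochronous g :=
    mem_connectedComponentIn ⟨by simp [lorentzGroup], det_one⟩
  have h0 : 0 < (B * Λ * B⁻¹) 0 0 := by
    by_contra! hle
    -- The entry is `1` at the identity and its square is at least `1` on the whole component, so it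
    -- cannot pass through `0`.
    have hcont : Continuous fun X : Mat4 => (B * X * B⁻¹) 0 0 := by fun_prop
    obtain ⟨X, hX, hX0⟩ := isPreconnected_connectedComponentIn.intermediate_value hΛ h1
      hcont.continuousOn (show (0 : ℝ) ∈ Set.Icc _ _ from ⟨hle, by simp [hBA]⟩)
    have := sq_zero_zero (hmem X (hsub hX)).1
    simp only at hX0
    rw [hX0] at this
    nlinarith [sq_nonneg ((B * X * B⁻¹) 0 1), sq_nonneg ((B * X * B⁻¹) 0 2),
      sq_nonneg ((B * X * B⁻¹) 0 3)]
  have := (hasNormalForm_eta (hmem Λ (hsub hΛ)).1 (hmem Λ (hsub hΛ)).2 h0).conj hg hBA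
  rwa [show B⁻¹ * (B * Λ * B⁻¹) * B = (B⁻¹ * B) * Λ * (B⁻¹ * B) by simp only [mul_assoc], hAB,
    one_mul, mul_one] at this

/-- A negative product of four reals has one or three negative factors, so exactly one index has the
exceptional sign. -/
theorem exists_sign_pattern {l : Fin 4 → ℝ} (h : ∏ i, l i < 0) :
    ∃ i, (∀ k, if k = i then l k < 0 else 0 < l k) ∨ ∀ k, if k = i then 0 < l k else l k < 0 := by
  rw [Fin.prod_univ_four] at h
  simp only [mul_neg_iff, mul_pos_iff] at h
  have hf : ∀ P : Fin 4 → Prop, (∀ k, P k) ↔ P 0 ∧ P 1 ∧ P 2 ∧ P 3 := by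
    simp [Fin.forall_fin_succ]
  simp only [hf]
  casesm* _ ∧ _, _ ∨ _
  all_goals first
    | (refine ⟨0, .inl ?_⟩; simp [*]; done)
    | (refine ⟨1, .inl ?_⟩; simp [*]; done)
    | (refine ⟨2, .inl ?_⟩; simp [*]; done)
    | (refine ⟨3, .inl ?_⟩; simp [*]; done)
    | (refine ⟨0, .inr ?_⟩; simp [*]; done)
    | (refine ⟨1, .inr ?_⟩; simp [*]; done)
    | (refine ⟨2, .inr ?_⟩; simp [*]; done)
    | (refine ⟨3, .inr ?_⟩; simp [*]; done)

/-- Sylvester's law of inertia for metrics of negative determinant. -/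
theorem IsLorentzMetric.exists_congruent {g : Mat4} (hg : IsLorentzMetric g) :
    ∃ B : Mat4, IsUnit B.det ∧ (g = Bᵀ * eta * B ∨ -g = Bᵀ * eta * B) := by
  have hH : g.IsHermitian := by
    rw [IsHermitian, conjTranspose_eq_transpose_of_trivial]
    exact hg.symm
  set l := hH.eigenvalues
  set Q : Mat4 := hH.eigenvectorUnitary.1
  have hgQ : ∀ i j, g i j = ∑ k, Q i k * l k * Q j k := by
    intro i j
    have := congrFun₂ hH.spectral_theorem i j
    rw [this]
    simp [Unitary.conjStarAlgAut_apply, mul_apply, diagonal_apply, Q, l, star_apply]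
  have hl : ∏ i, l i < 0 := by
    have := hg.det_neg
    rw [hH.det_eq_prod_eigenvalues] at this
    simpa using this
  -- The congruence is `√|l| Qᵀ` with rows permuted by `σ`; later `σ` moves the exceptional
  -- eigenvalue to index `0` and `e = ±1` fixes the overall sign.
  have key : ∀ (e : ℝ) (σ : Equiv.Perm (Fin 4)), (∀ k, e * l (σ k) = ![-1, 1, 1, 1] k * |l (σ k)|) →
      e • g = ((diagonal fun k => √|l (σ k)|) * Qᵀ.submatrix σ id)ᵀ * eta *
        ((diagonal fun k => √|l (σ k)|) * Qᵀ.submatrix σ id) := by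
    intro e σ h
    ext i j
    rw [Matrix.smul_apply, hgQ, ← Equiv.sum_comp σ, eta, Matrix.mul_assoc, mul_apply, smul_eq_mul,
      Finset.mul_sum]
    refine Finset.sum_congr rfl fun k _ => ?_
    have hs : √|l (σ k)| * √|l (σ k)| = |l (σ k)| := Real.mul_self_sqrt (abs_nonneg _)
    simp only [transpose_apply, diagonal_mul, submatrix_apply, id]
    linear_combination Q i (σ k) * Q j (σ k) * (h k - ![-1, 1, 1, 1] k * hs)
  have hunit : ∀ B : Mat4, g = Bᵀ * eta * B ∨ -g = Bᵀ * eta * B → IsUnit B.det := by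
    intro B hB
    refine Ne.isUnit fun h => hg.det_neg.ne ?_
    obtain hB | hB := hB
    · rw [hB, det_mul, h, mul_zero]
    · rw [← neg_neg g, hB, Matrix.det_neg, det_mul, h, mul_zero, mul_zero]
  suffices ∃ B : Mat4, g = Bᵀ * eta * B ∨ -g = Bᵀ * eta * B by
    obtain ⟨B, hB⟩ := this
    exact ⟨B, hunit B hB, hB⟩
  have hσ : ∀ i k : Fin 4, Equiv.swap 0 i k = i ↔ k = 0 := by
    intro i k
    rw [Equiv.swap_apply_eq_iff, Equiv.swap_apply_right]
  obtain ⟨i, h | h⟩ := exists_sign_pattern hl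
  · refine ⟨_, .inl ((one_smul ℝ g).symm.trans (key 1 (Equiv.swap 0 i) fun k => ?_))⟩
    have := h (Equiv.swap 0 i k)
    simp only [hσ] at this
    fin_cases k <;> simp at this ⊢
    · rw [abs_of_neg this, neg_neg]
    all_goals rw [abs_of_pos this]
  · refine ⟨_, .inr ((neg_one_smul ℝ g).symm.trans (key (-1) (Equiv.swap 0 i) fun k => ?_))⟩
    have := h (Equiv.swap 0 i k)
    simp only [hσ] at this
    fin_cases k <;> simp at this ⊢
    · rw [abs_of_pos this]
    all_goals rw [abs_of_neg this]

theorem hasNormalForm {g Λ : Mat4} (hg : IsLorentzMetric g) (hΛ : Λ ∈ properOrthochronous g) :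
    HasNormalForm g Λ := by
  obtain ⟨B, hB, h | h⟩ := hg.exists_congruent
  · exact hasNormalForm_of_congruent h hB hΛ
  -- `g` and `-g` have the same Lorentz group, hence the same identity component.
  · refine (hasNormalForm_of_congruent h hB ?_).of_neg
    simpa [properOrthochronous, properLorentzGroup, lorentzGroup] using hΛ

end LorentzDecomp

/-- The first group of conjuncts says that the square root, `cosh⁻¹` and `cos⁻¹` defining `c₊`,
`c₋` are taken inside their domains, and that the denominator `2 (c₊ - c₋)` is nonzero. -/
theorem mainTheorem2 (g : LorentzDecomp.Mat4) (hg : LorentzDecomp.IsLorentzMetric g)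
    (Λ : LorentzDecomp.Mat4) (hΛ : Λ ∈ LorentzDecomp.properOrthochronous g)
    (hns : ¬ LorentzDecomp.IsSimpleLorentz g Λ) :
    (0 ≤ LorentzDecomp.discr Λ ∧
      LorentzDecomp.cPlus Λ = (Λ.trace + √(LorentzDecomp.discr Λ)) / 4 ∧
      LorentzDecomp.cMinus Λ = (Λ.trace - √(LorentzDecomp.discr Λ)) / 4 ∧
      1 < LorentzDecomp.cPlus Λ ∧ -1 ≤ LorentzDecomp.cMinus Λ ∧ LorentzDecomp.cMinus Λ < 1) ∧
    Λ = LorentzDecomp.factorPlus Λ * LorentzDecomp.factorMinus Λ ∧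
    Commute (LorentzDecomp.factorPlus Λ) (LorentzDecomp.factorMinus Λ) ∧
    LorentzDecomp.IsSimpleLorentz g (LorentzDecomp.factorPlus Λ) ∧
    LorentzDecomp.IsSimpleLorentz g (LorentzDecomp.factorMinus Λ) :=
  LorentzDecomp.decomposition_of_normalForm hg (LorentzDecomp.hasNormalForm hg hΛ) hns
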